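/- Let $K$ be a non-Archimedean local field with normalized absolute value $|\cdot|_K$, so that $|\beta|_K=q^{-1}$ for a generator $\beta$ of the maximal ideal $P$ of the ring of integers $O=\{|x|_K\le 1\}$, where $q=|O/P|$. Let $n\ge 1$, $N\in\mathbb Z$, $\alpha>0$. On $K^n$ put $\|x\|=\max_j|x_j|_K$ and let $dx$ be the (completed) Haar measure with $\int_{O^n}dx=1$. Let $\Omega=B_N=\{x\in K^n:\|x\|\le q^N\}$, $\Omega^c=K^n\setminus\Omega$, $Q=(K^n\times K^n)\setminus(\Omega^c\times\Omega^c)$, $c_{n,\alpha}=\frac{q^\alpha-1}{1-q^{-\alpha-n}}$, and $$(D^{\alpha,n}u)(x)=c_{n,\alpha}\int_{K^n}\frac{u(x)-u(y)}{\|x-y\|^{n+\alpha}}\,dy\ \ (x\in\Omega),\qquad (\mathcal N_\alpha u)(x)=c_{n,\alpha}\int_\Omega\frac{u(x)-u(y)}{\|x-y\|^{n+\alpha}}\,dy\ \ (x\in\Omega^c).$$ For $\rho\in L^1(\Omega^c)$ let $H^\alpha_{\Omega,\rho}$ be the space of measurable $u:K^n\to\mathbb R$ with $$\int_\Omega u^2\,dx+\int_{\Omega^c}|\rho|\,u^2\,dx+\iint_{Q}\frac{|u(x)-u(y)|^2}{\|x-y\|^{n+\alpha}}\,dx\,dy<\infty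 ,$$ and let $H^\alpha_\Omega$ be this space for $\rho=0$. For real-valued $f\in L^2(\Omega)$ and $g\in L^1(\Omega^c)$, a weak solution in $H^\alpha_\Omega$ of the Neumann problem $$D^{\alpha,n}u=f\ \text{ on }\Omega,\qquad \mathcal N_\alpha u=g\ \text{ on }\Omega^c$$ is a function $u\in H^\alpha_\Omega$ such that for every $v\in H^\alpha_{\Omega,g}$ $$\frac{c_{n,\alpha}}2\iint_{Q}\frac{(u(x)-u(y))(v(x)-v(y))}{\|x-y\|^{n+\alpha}}\,dx\,dy=\int_\Omega f v\,dx+\int_{\Omega^c} g v\,dy .$$ **Theorem.** Let $f\in L^2(\Omega)$ and $g\in L^1(\Omega^c)$ be real-valued, and suppose that there is a bounded function $\psi:K^n\to\mathbb R$ which is locally constant (for some $\ell\in\mathbb Z$, $\psi(x+x')=\psi(x)$ for all $x,x'\in K^n$ with $\|x'\|\le q^{-\ell}$) such that $\mathcal N_\alpha\psi=g$ almost everywhere on $\Omega^c$. Then the Neumann problem has a weak solution in $H^\alpha_\Omega$ if and only if $$\int_\Omega f(x)\,dx=-\int_{\Omega^c}g(y)\,dy .$$ When this holds, the solution is unique up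 to an additive constant: if $u$ is a weak solution, then a function $w:K^n\to\mathbb R$ is a weak solution if and only if $w=u+k$ almost everywhere for some constant $k\in\mathbb R$. -/

import Mathlib

open MeasureTheory Set
open scoped NormedField Valued ENNReal

namespace LocalFieldNeumann

noncomputable section

/-- The residue cardinality `q = |O / P|`, where `O = {|x| ≤ 1}` and `P = {|x| < 1}`. -/
def residueCard (K : Type*) [NontriviallyNormedField K] [IsUltrametricDist K] : ℕ :=
  Nat.card (IsLocalRing.ResidueField 𝒪[K])

/-- The absolute value of `K` is normalized: the ideal `P = {|x| < 1}` of the ring of integers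
`O = {|x| ≤ 1}` is generated by an element `β` with `|β| = q⁻¹`. -/
def IsNormalizedAbs (K : Type*) [NontriviallyNormedField K] [IsUltrametricDist K] : Prop :=
  ∃ β : K, {x : K | ‖x‖ < 1} = (fun y => β * y) '' {y : K | ‖y‖ ≤ 1} ∧
    ‖β‖ = (residueCard K : ℝ)⁻¹

/-- The ring of integers `O = {|x| ≤ 1}` as a compact set with nonempty interior. -/
def integerBall (K : Type*) [NontriviallyNormedField K] [LocallyCompactSpace K] :
    TopologicalSpace.PositiveCompacts K where
  carrier := Metric.closedBall 0 1
  isCompact' := by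
    have : ProperSpace K := ProperSpace.of_locallyCompactSpace K
    exact isCompact_closedBall 0 1
  interior_nonempty' :=
    ⟨0, mem_interior_iff_mem_nhds.2 (Metric.closedBall_mem_nhds 0 one_pos)⟩

/-- The Haar measure `dx` on `K^n`, the product of the additive Haar measures of `K` that give
mass `1` to the ring of integers. The norm `‖x‖` on `Fin n → K` is the maximum of the absolute
values of the coordinates. -/
def haar (K : Type*) [NontriviallyNormedField K] [LocallyCompactSpace K]
    [MeasurableSpace K] [BorelSpace K] (n : ℕ) : Measure (Fin n → K) :=
  Measure.pi fun _ => Measure.addHaarMeasure (integerBall K)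

/-- The ball `B_N = {x ∈ K^n : ‖x‖ ≤ q^N}`. -/
def ball (K : Type*) [NontriviallyNormedField K] [IsUltrametricDist K] (n : ℕ) (N : ℤ) :
    Set (Fin n → K) :=
  {x | ‖x‖ ≤ (residueCard K : ℝ) ^ N}

/-- The set `(K^n × K^n) \ (Ω^c × Ω^c)` for `Ω = B_N`. -/
def crossRegion (K : Type*) [NontriviallyNormedField K] [IsUltrametricDist K] (n : ℕ) (N : ℤ) :
    Set ((Fin n → K) × (Fin n → K)) :=
  ((ball K n N)ᶜ ×ˢ (ball K n N)ᶜ)ᶜ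

/-- The constant `c_{n,α} = (q^α - 1) / (1 - q^{-α-n})`. -/
def normConst (K : Type*) [NontriviallyNormedField K] [IsUltrametricDist K] (n : ℕ) (α : ℝ) : ℝ :=
  ((residueCard K : ℝ) ^ α - 1) / (1 - (residueCard K : ℝ) ^ (-α - (n : ℝ)))

/-- A function on `K^n` is locally constant if, for some integer `ℓ`, it is invariant under all
shifts by vectors of norm at most `q^{-ℓ}`. -/
def IsLocConst {K : Type*} [NontriviallyNormedField K] [IsUltrametricDist K] {n : ℕ}
    (ψ : (Fin n → K) → ℝ) : Prop :=
  ∃ l : ℤ, ∀ x x' : Fin n → K, ‖x'‖ ≤ (residueCard K : ℝ) ^ (-l) → ψ (x + x') = ψ x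

section Measured

variable {K : Type*} [NontriviallyNormedField K] [IsUltrametricDist K] [LocallyCompactSpace K]
  [MeasurableSpace K] [BorelSpace K] {n : ℕ}

/-- The operator `(𝒩_α u)(x) = c_{n,α} ∫_Ω (u(x) - u(y)) / ‖x - y‖^{n+α} dy`, used for `x ∉ Ω`. -/
def neumannOp (N : ℤ) (α : ℝ) (u : (Fin n → K) → ℝ) (x : Fin n → K) : ℝ :=
  normConst K n α * ∫ y in ball K n N, (u x - u y) / ‖x - y‖ ^ ((n : ℝ) + α) ∂(haar K n)

/-- The square of the norm of `H^α_{Ω,ρ}`, with values in `[0, ∞]`. -/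
def sobolevNormSq (N : ℤ) (α : ℝ) (ρ u : (Fin n → K) → ℝ) : ℝ≥0∞ :=
  (∫⁻ x in ball K n N, ENNReal.ofReal (u x ^ 2) ∂(haar K n))
  + (∫⁻ x in (ball K n N)ᶜ, ENNReal.ofReal (|ρ x| * u x ^ 2) ∂(haar K n))
  + ∫⁻ p in crossRegion K n N,
      ENNReal.ofReal ((u p.1 - u p.2) ^ 2 / ‖p.1 - p.2‖ ^ ((n : ℝ) + α))
      ∂((haar K n).prod (haar K n))

/-- Membership in the space `H^α_{Ω,ρ}`: measurable functions (for the completed Haar measure)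
with finite norm. -/
def MemSobolev (N : ℤ) (α : ℝ) (ρ u : (Fin n → K) → ℝ) : Prop :=
  AEMeasurable u (haar K n) ∧ sobolevNormSq N α ρ u < ∞

/-- The bilinear form
`∫∫_{(K^n × K^n) \ (Ω^c × Ω^c)} (u(x) - u(y)) (v(x) - v(y)) / ‖x - y‖^{n+α} dx dy`. -/
def energyForm (N : ℤ) (α : ℝ) (u v : (Fin n → K) → ℝ) : ℝ :=
  ∫ p in crossRegion K n N,
    (u p.1 - u p.2) * (v p.1 - v p.2) / ‖p.1 - p.2‖ ^ ((n : ℝ) + α)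
    ∂((haar K n).prod (haar K n))

/-- `u` is a weak solution of the problem `D^{α,n} u = f` on `Ω = B_N`, `𝒩_α u = g` on `Ω^c`:
it lies in `H^α_{Ω,0}`, and the weak equation holds for all test functions `v` in `H^α_{Ω,g}`. -/
def IsWeakSolution (N : ℤ) (α : ℝ) (f g u : (Fin n → K) → ℝ) : Prop :=
  MemSobolev N α (fun _ => 0) u ∧
    ∀ v : (Fin n → K) → ℝ, MemSobolev N α g v →
      normConst K n α / 2 * energyForm N α u v =
        (∫ x in ball K n N, f x * v x ∂(haar K n))
        + ∫ y in (ball K n N)ᶜ, g y * v y ∂(haar K n)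

end Measured

end

end LocalFieldNeumann

namespace LocalFieldNeumann

open Filter Topology

/-! Let `R = q ^ N`, `s = n + α`, and let `ν` be the measure `‖x - y‖⁻ˢ dx dy` on `Q`. The weak
equation reads `(c/2) ∫ Du Dv dν = ∫ F v`, where `Du(x, y) = u x - u y` and `F` is `f` on `Ω` and
`g` off it. Testing with `v = 1` gives `∫ F = 0`. Conversely, if `∫ F = 0`, then integrating `F y *
(v x - v y)` over `x ∈ Ω` and all `y` gives `-|Ω| ∫ F v`. So `∫ F v = ∫ G Dv dν` with the explicit
kernel `G = -|Ω|⁻¹ 1_Ω(x) F(y) / κ(x, y)` (`integral_functionalKernel_mul_difference`). This `G`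
lies in `L²(ν)` (`memLp_functionalKernel`), the differences form a closed subspace
(`isClosed_differences`), and the orthogonal projection of `G` onto it is `Du` for a solution `u`,
up to the factor `2/c`. No Poincaré inequality is needed. The bound on `ψ` gives `|g| ≤ C ω` with `ω
y = max(R, ‖y‖)⁻ˢ`, and `ω y ≤ κ(x, y)` for `x ∈ Ω`. Hence `F² / ω` is integrable, and both Sobolev
spaces consist of exactly the functions of finite energy (`memSobolev_iff`). Two solutions differ by
a function with `D = 0` a.e., hence by a constant. -/

/-- The elements of `L²(ν)` that are a.e. of the form `(x, y) ↦ u x - u y`. -/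
def differences {X : Type*} [MeasurableSpace X] (μ : Measure X) (ν : Measure (X × X)) :
    Submodule ℝ (Lp ℝ 2 ν) where
  carrier := {F | ∃ u : X → ℝ, AEMeasurable u μ ∧ F =ᵐ[ν] fun p => u p.1 - u p.2}
  add_mem' := by
    rintro F G ⟨u, hu, hFu⟩ ⟨v, hv, hGv⟩
    refine ⟨u + v, hu.add hv, ?_⟩
    filter_upwards [hFu, hGv, Lp.coeFn_add F G] with p h1 h2 h3
    simp only [h3, Pi.add_apply, h1, h2]
    ring
  zero_mem' := ⟨0, aemeasurable_const, by
    filter_upwards [Lp.coeFn_zero ℝ 2 ν] with p h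
    simpa using h⟩
  smul_mem' := by
    rintro c F ⟨u, hu, hFu⟩
    refine ⟨c • u, hu.const_smul c, ?_⟩
    filter_upwards [hFu, Lp.coeFn_smul c F] with p h1 h2
    simp only [h2, Pi.smul_apply, h1, smul_eq_mul]
    ring

/-! ### Differences as a closed subspace of `L²(ν)` -/

section Differences

variable {X : Type*} [MeasurableSpace X] {μ : Measure X} {ν : Measure (X × X)}
  {Ω : Set X}

theorem ae_fst_snd_of_ae (hν : ν ≪ μ.prod μ) {P : X → Prop} (h : ∀ᵐ x ∂μ, P x) :
    ∀ᵐ p ∂ν, P p.1 ∧ P p.2 := by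
  refine hν.ae_le ?_
  filter_upwards [Measure.quasiMeasurePreserving_fst.ae h,
    Measure.quasiMeasurePreserving_snd.ae h] with p h1 h2 using ⟨h1, h2⟩

theorem aemeasurable_difference (hν : ν ≪ μ.prod μ) {u : X → ℝ} (hu : AEMeasurable u μ) :
    AEMeasurable (fun p : X × X => u p.1 - u p.2) ν :=
  ((hu.comp_quasiMeasurePreserving Measure.quasiMeasurePreserving_fst).sub
    (hu.comp_quasiMeasurePreserving Measure.quasiMeasurePreserving_snd)).mono_ac hν

variable [SFinite μ]

/-- Provides a base point: one slice `{x} × X` with `x ∈ Ω` sees all of `X`, so functions can be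
normalized at `x`. -/
theorem exists_mem_ae_of_ae_prod (hΩν : (μ.restrict Ω).prod μ ≪ ν) (hΩ : MeasurableSet Ω)
    (hΩ0 : μ Ω ≠ 0) {P : X × X → Prop} (h : ∀ᵐ p ∂ν, P p) :
    ∃ x ∈ Ω, ∀ᵐ y ∂μ, P (x, y) := by
  have h1 := Measure.ae_ae_of_ae_prod (hΩν.ae_le h)
  have : (ae (μ.restrict Ω)).NeBot := by
    rw [ae_neBot]
    simpa [Measure.restrict_eq_zero] using hΩ0
  obtain ⟨x, hx, hxΩ⟩ := (h1.and (ae_restrict_mem hΩ)).exists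
  exact ⟨x, hxΩ, hx⟩

/-- A convergent sequence of differences has an a.e. convergent subsequence. Subtracting the values
at a good base point makes the functions themselves converge a.e., and the limit of the differences
is the difference of the limit. -/
theorem isClosed_differences (hν : ν ≪ μ.prod μ) (hΩν : (μ.restrict Ω).prod μ ≪ ν)
    (hΩ : MeasurableSet Ω) (hΩ0 : μ Ω ≠ 0) :
    IsClosed (differences μ ν : Set (Lp ℝ 2 ν)) := by
  refine IsSeqClosed.isClosed ?_
  intro F F₀ hF hlim
  choose u hu hFu using hF
  obtain ⟨ns, -, hns⟩ := (tendstoInMeasure_of_tendsto_Lp hlim).exists_seq_tendsto_ae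
  have hconv : ∀ᵐ p ∂ν, Tendsto (fun k => u (ns k) p.1 - u (ns k) p.2) atTop (𝓝 (F₀ p)) := by
    filter_upwards [hns, ae_all_iff.2 hFu] with p h1 h2
    simpa [h2] using h1
  obtain ⟨x₀, -, hx₀⟩ := exists_mem_ae_of_ae_prod hΩν hΩ hΩ0 hconv
  have hw : ∀ᵐ y ∂μ, Tendsto (fun k => u (ns k) y - u (ns k) x₀) atTop (𝓝 (-F₀ (x₀, y))) := by
    filter_upwards [hx₀] with y hy
    simpa using hy.neg
  refine ⟨fun y => -F₀ (x₀, y),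
    aemeasurable_of_tendsto_metrizable_ae atTop (fun k => (hu (ns k)).sub_const _) hw, ?_⟩
  filter_upwards [hconv, ae_fst_snd_of_ae hν hw] with p h1 h2
  refine tendsto_nhds_unique h1 ((h2.1.sub h2.2).congr fun k => ?_)
  ring

theorem exists_ae_eq_const_of_difference_eq_zero (hΩν : (μ.restrict Ω).prod μ ≪ ν)
    (hΩ : MeasurableSet Ω) (hΩ0 : μ Ω ≠ 0) {u : X → ℝ} (h : ∀ᵐ p ∂ν, u p.1 - u p.2 = 0) :
    ∃ k : ℝ, ∀ᵐ x ∂μ, u x = k := by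
  obtain ⟨x₀, -, hx₀⟩ := exists_mem_ae_of_ae_prod hΩν hΩ hΩ0 h
  refine ⟨u x₀, ?_⟩
  filter_upwards [hx₀] with y hy
  linarith

/-- The variational equation `∫ (Du) (Dv) dν = ∫ G (Dv) dν` is solvable for every `G ∈ L²(ν)`. -/
theorem exists_integral_difference_mul_eq (hν : ν ≪ μ.prod μ)
    (hΩν : (μ.restrict Ω).prod μ ≪ ν) (hΩ : MeasurableSet Ω) (hΩ0 : μ Ω ≠ 0)
    {G : X × X → ℝ} (hG : MemLp G 2 ν) :
    ∃ u : X → ℝ, AEMeasurable u μ ∧ MemLp (fun p : X × X => u p.1 - u p.2) 2 ν ∧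
      ∀ v : X → ℝ, AEMeasurable v μ → MemLp (fun p : X × X => v p.1 - v p.2) 2 ν →
        ∫ p, (u p.1 - u p.2) * (v p.1 - v p.2) ∂ν = ∫ p, G p * (v p.1 - v p.2) ∂ν := by
  have hcl := isClosed_differences hν hΩν hΩ hΩ0
  have : CompleteSpace (differences μ ν) := hcl.completeSpace_coe
  -- The projection of `G` onto the differences is itself some `Du`, and it has the same inner
  -- products with differences as `G`.
  obtain ⟨u, hu, hPu⟩ := ((differences μ ν).orthogonalProjectionOnto hG.toLp).2
  refine ⟨u, hu, (memLp_congr_ae hPu).1 (Lp.memLp _), fun v hv hDv => ?_⟩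
  have hmem : hDv.toLp ∈ differences μ ν := ⟨v, hv, hDv.coeFn_toLp⟩
  have key := (differences μ ν).inner_orthogonalProjectionOnto_eq_of_mem_left ⟨_, hmem⟩ hG.toLp
  simp only [L2.inner_def, Submodule.coe_inner] at key
  refine Eq.trans (integral_congr_ae ?_) (key.trans (integral_congr_ae ?_))
  · filter_upwards [hPu, hDv.coeFn_toLp] with p h1 h2
    rw [h1, h2]
    simp
  · filter_upwards [hG.coeFn_toLp, hDv.coeFn_toLp] with p h1 h2
    simp [h1, h2]

end Differences

/-! ### The energy measure of a general kernel `κ` with a lower weight `ω` -/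

/-- The measure `κ(x, y) dx dy` on the complement of `Ωᶜ × Ωᶜ`. -/
noncomputable def energyMeasure {X : Type*} [MeasurableSpace X] (μ : Measure X) (Ω : Set X)
    (κ : X × X → ℝ) : Measure (X × X) :=
  ((μ.prod μ).restrict (Ωᶜ ×ˢ Ωᶜ)ᶜ).withDensity fun p => ENNReal.ofReal (κ p)

section EnergyMeasure

variable {X : Type*} [MeasurableSpace X] {μ : Measure X} {Ω : Set X} {κ : X × X → ℝ} {ω : X → ℝ}

theorem energyMeasure_absolutelyContinuous : energyMeasure μ Ω κ ≪ μ.prod μ :=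
  (withDensity_absolutelyContinuous _ _).trans Measure.restrict_le_self.absolutelyContinuous

theorem lintegral_energyMeasure (hκ : Measurable κ) (h : X × X → ℝ≥0∞) :
    ∫⁻ p, h p ∂(energyMeasure μ Ω κ) =
      ∫⁻ p in (Ωᶜ ×ˢ Ωᶜ)ᶜ, ENNReal.ofReal (κ p) * h p ∂(μ.prod μ) :=
  lintegral_withDensity_eq_lintegral_mul_non_measurable _ hκ.ennreal_ofReal
    (Eventually.of_forall fun _ => ENNReal.ofReal_lt_top) h

theorem integral_energyMeasure (hκ : Measurable κ) (hκ0 : ∀ p, 0 < κ p) (h : X × X → ℝ) :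
    ∫ p, h p ∂(energyMeasure μ Ω κ) = ∫ p in (Ωᶜ ×ˢ Ωᶜ)ᶜ, κ p * h p ∂(μ.prod μ) := by
  rw [energyMeasure, integral_withDensity_eq_integral_toReal_smul hκ.ennreal_ofReal
    (Eventually.of_forall fun _ => ENNReal.ofReal_lt_top)]
  simp only [ENNReal.toReal_ofReal (hκ0 _).le, smul_eq_mul]

theorem integrable_energyMeasure_iff (hκ : Measurable κ) (hκ0 : ∀ p, 0 < κ p) {h : X × X → ℝ} :
    Integrable h (energyMeasure μ Ω κ) ↔
      IntegrableOn (fun p => κ p * h p) (Ωᶜ ×ˢ Ωᶜ)ᶜ (μ.prod μ) := by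
  rw [energyMeasure, integrable_withDensity_iff_integrable_smul' hκ.ennreal_ofReal
    (Eventually.of_forall fun _ => ENNReal.ofReal_lt_top)]
  simp only [ENNReal.toReal_ofReal (hκ0 _).le, smul_eq_mul, IntegrableOn]

theorem memLp_difference_iff (hκ : Measurable κ) {u : X → ℝ} (hu : AEMeasurable u μ) :
    MemLp (fun p : X × X => u p.1 - u p.2) 2 (energyMeasure μ Ω κ) ↔
      ∫⁻ p in (Ωᶜ ×ˢ Ωᶜ)ᶜ, ENNReal.ofReal (κ p) * ENNReal.ofReal ((u p.1 - u p.2) ^ 2)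
        ∂(μ.prod μ) < ∞ := by
  have hm := (aemeasurable_difference (energyMeasure_absolutelyContinuous (Ω := Ω) (κ := κ))
    hu).aestronglyMeasurable
  rw [memLp_two_iff_integrable_sq hm, ← lintegral_energyMeasure hκ, Integrable,
    hasFiniteIntegral_iff_ofReal (Eventually.of_forall fun p => sq_nonneg _)]
  exact and_iff_right (hm.pow 2)

/-- The representative in `L²` of the energy measure of the functional `v ↦ ∫ F v`. -/
noncomputable def functionalKernel (μ : Measure X) (Ω : Set X) (κ : X × X → ℝ) (F : X → ℝ)
    (p : X × X) : ℝ :=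
  -(μ.real Ω)⁻¹ * (Ω.indicator 1 p.1 * F p.2) / κ p

/-- The kernel lives on `x ∈ Ω`, where `κ G² = |Ω|⁻² F(y)² / κ ≤ |Ω|⁻² F(y)² / ω(y)`; this is
integrable over `Ω × X` because `Ω` has finite measure. -/
theorem memLp_functionalKernel (hκ : Measurable κ) (hκ0 : ∀ p, 0 < κ p) (hω0 : ∀ y, 0 < ω y)
    (hωκ : ∀ x ∈ Ω, ∀ y, ω y ≤ κ (x, y)) (hΩ : MeasurableSet Ω) (hΩt : μ Ω ≠ ∞)
    {F : X → ℝ} (hF : AEStronglyMeasurable F μ) (hFω : Integrable (fun y => F y ^ 2 / ω y) μ) :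
    MemLp (functionalKernel μ Ω κ F) 2 (energyMeasure μ Ω κ) := by
  have h1 : Integrable (Ω.indicator (1 : X → ℝ)) μ :=
    (integrableOn_const hΩt).integrable_indicator hΩ
  have hG : AEStronglyMeasurable (functionalKernel μ Ω κ F) (μ.prod μ) :=
    ((((h1.aestronglyMeasurable.comp_fst (ν := μ)).mul (hF.comp_snd (μ := μ))).const_mul
      (-(μ.real Ω)⁻¹)).aemeasurable.div hκ.aemeasurable).aestronglyMeasurable
  rw [memLp_two_iff_integrable_sq (hG.mono_ac energyMeasure_absolutelyContinuous),
    integrable_energyMeasure_iff hκ hκ0]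
  refine Integrable.mono' (((h1.mul_prod hFω).const_mul ((μ.real Ω)⁻¹ ^ 2)).integrableOn)
    (hκ.aestronglyMeasurable.mul (hG.restrict.pow 2)) (Eventually.of_forall fun p => ?_)
  rw [Real.norm_of_nonneg (mul_nonneg (hκ0 p).le (sq_nonneg _)), functionalKernel]
  by_cases hp : p.1 ∈ Ω
  · simp only [indicator_of_mem hp, Pi.one_apply, one_mul]
    have h2 : F p.2 ^ 2 / κ p ≤ F p.2 ^ 2 / ω p.2 :=
      div_le_div_of_nonneg_left (sq_nonneg _) (hω0 _) (hωκ p.1 hp p.2)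
    calc κ p * (-(μ.real Ω)⁻¹ * F p.2 / κ p) ^ 2 = (μ.real Ω)⁻¹ ^ 2 * (F p.2 ^ 2 / κ p) := by
          have := (hκ0 p).ne'
          field_simp
      _ ≤ _ := mul_le_mul_of_nonneg_left h2 (sq_nonneg _)
  · simp [indicator_of_notMem hp]

variable [SFinite μ]

theorem restrict_prod_absolutelyContinuous_energyMeasure (hκ : Measurable κ)
    (hκ0 : ∀ p, 0 < κ p) : (μ.restrict Ω).prod μ ≪ energyMeasure μ Ω κ := by
  have h : (μ.restrict Ω).prod μ = (μ.prod μ).restrict (Ω ×ˢ univ) := by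
    rw [← Measure.prod_restrict, Measure.restrict_univ]
  rw [h]
  refine (Measure.restrict_mono ?_ le_rfl).absolutelyContinuous.trans
    (withDensity_absolutelyContinuous' hκ.ennreal_ofReal.aemeasurable
      (Eventually.of_forall fun p => (ENNReal.ofReal_pos.2 (hκ0 p)).ne'))
  rintro p ⟨h1, -⟩ ⟨h2, -⟩
  exact h2 h1

theorem lintegral_restrict_prod_le_energyMeasure (hκ : Measurable κ)
    (hωκ : ∀ x ∈ Ω, ∀ y, ω y ≤ κ (x, y)) (hΩ : MeasurableSet Ω) (h : X × X → ℝ≥0∞) :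
    ∫⁻ p, ENNReal.ofReal (ω p.2) * h p ∂((μ.restrict Ω).prod μ) ≤
      ∫⁻ p, h p ∂(energyMeasure μ Ω κ) := by
  have h' : (μ.restrict Ω).prod μ = (μ.prod μ).restrict (Ω ×ˢ univ) := by
    rw [← Measure.prod_restrict, Measure.restrict_univ]
  rw [lintegral_energyMeasure hκ, h']
  refine (setLIntegral_mono' (hΩ.prod MeasurableSet.univ) fun p hp => ?_).trans
    (lintegral_mono_set ?_)
  · exact mul_le_mul_left (ENNReal.ofReal_le_ofReal (hωκ p.1 hp.1 p.2)) _
  · rintro p ⟨h1, -⟩ ⟨h2, -⟩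
    exact h2 h1

/-- A function of finite energy is square integrable against every integrable weight that is
dominated by `ω`. -/
theorem integrableOn_mul_sq (hκ : Measurable κ) (hω : Measurable ω) (hω0 : ∀ y, 0 < ω y)
    (hωκ : ∀ x ∈ Ω, ∀ y, ω y ≤ κ (x, y)) (hΩ : MeasurableSet Ω) (hΩ0 : μ Ω ≠ 0)
    {u : X → ℝ} (hu : AEMeasurable u μ)
    (hDu : MemLp (fun p : X × X => u p.1 - u p.2) 2 (energyMeasure μ Ω κ))
    {S : Set X} {ρ : X → ℝ} (hρ : IntegrableOn ρ S μ) {C : ℝ}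
    (hρω : ∀ᵐ x ∂(μ.restrict S), |ρ x| ≤ C * ω x) :
    IntegrableOn (fun x => ρ x * u x ^ 2) S μ := by
  have hfin : ∫⁻ p, ENNReal.ofReal (ω p.2) * ENNReal.ofReal ((u p.1 - u p.2) ^ 2)
      ∂((μ.restrict Ω).prod μ) < ∞ := by
    refine (lintegral_restrict_prod_le_energyMeasure hκ hωκ hΩ _).trans_lt ?_
    rw [lintegral_energyMeasure hκ]
    exact (memLp_difference_iff hκ hu).1 hDu
  have huΩ : AEMeasurable (fun p : X × X => u p.1 - u p.2) ((μ.restrict Ω).prod μ) :=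
    aemeasurable_difference (Measure.AbsolutelyContinuous.prod
      Measure.restrict_le_self.absolutelyContinuous Measure.AbsolutelyContinuous.rfl) hu
  have hmeas : AEMeasurable
      (fun p : X × X => ENNReal.ofReal (ω p.2) * ENNReal.ofReal ((u p.1 - u p.2) ^ 2))
      ((μ.restrict Ω).prod μ) :=
    (hω.comp measurable_snd).ennreal_ofReal.aemeasurable.mul (huΩ.pow_const 2).ennreal_ofReal
  rw [lintegral_prod _ hmeas] at hfin
  have hae := ae_lt_top' hmeas.lintegral_prod_right' hfin.ne
  have : (ae (μ.restrict Ω)).NeBot := by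
    rw [ae_neBot]
    simpa [Measure.restrict_eq_zero] using hΩ0
  -- By Tonelli, some slice `x₀` has finite `∫ ω(y) (u x₀ - u y)² dy`; then `u y` is compared with
  -- the constant `u x₀`.
  obtain ⟨x₀, hx₀⟩ := hae.exists
  have hint : Integrable (fun y => ω y * (u x₀ - u y) ^ 2) μ := by
    refine ⟨(hω.aemeasurable.mul ((hu.const_sub _).pow_const 2)).aestronglyMeasurable, ?_⟩
    rw [hasFiniteIntegral_iff_ofReal
      (Eventually.of_forall fun y => mul_nonneg (hω0 y).le (sq_nonneg _))]
    simpa only [ENNReal.ofReal_mul (hω0 _).le] using hx₀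
  refine Integrable.mono' (((hρ.abs).const_mul (2 * u x₀ ^ 2)).add
    ((hint.integrableOn (s := S)).const_mul (2 * C)))
    (hρ.aestronglyMeasurable.mul (hu.restrict.pow_const 2).aestronglyMeasurable) ?_
  filter_upwards [hρω] with y hy
  simp only [Pi.add_apply, norm_mul, Real.norm_eq_abs, abs_pow, sq_abs]
  have h1 : u y ^ 2 ≤ 2 * u x₀ ^ 2 + 2 * (u x₀ - u y) ^ 2 := by
    nlinarith [sq_nonneg (2 * u x₀ - u y)]
  have h2 := mul_le_mul_of_nonneg_left h1 (abs_nonneg (ρ y))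
  have h3 := mul_le_mul_of_nonneg_right hy (sq_nonneg (u x₀ - u y))
  linarith

/-- The factor `κ` cancels, and Fubini leaves `-|Ω|⁻¹ (∫_Ω v · ∫ F - |Ω| ∫ F v)`; the first product
vanishes since `F` has mean zero. -/
theorem integral_functionalKernel_mul_difference (hκ : Measurable κ) (hκ0 : ∀ p, 0 < κ p)
    (hΩ : MeasurableSet Ω) (hΩt : μ Ω ≠ ∞) (hΩ0 : μ Ω ≠ 0)
    {F v : X → ℝ} (hF : Integrable F μ) (hF0 : ∫ x, F x ∂μ = 0) (hv : IntegrableOn v Ω μ)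
    (hFv : Integrable (fun x => F x * v x) μ) :
    ∫ p, functionalKernel μ Ω κ F p * (v p.1 - v p.2) ∂(energyMeasure μ Ω κ) =
      ∫ x, F x * v x ∂μ := by
  have h1 : Integrable (Ω.indicator (1 : X → ℝ)) μ :=
    (integrableOn_const hΩt).integrable_indicator hΩ
  have hne : μ.real Ω ≠ 0 := ENNReal.toReal_ne_zero.2 ⟨hΩ0, hΩt⟩
  rw [integral_energyMeasure hκ hκ0, setIntegral_eq_integral_of_forall_compl_eq_zero]
  · calc ∫ p, κ p * (functionalKernel μ Ω κ F p * (v p.1 - v p.2)) ∂(μ.prod μ)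
        = ∫ p : X × X, -(μ.real Ω)⁻¹ * (Ω.indicator v p.1 * F p.2
            - Ω.indicator 1 p.1 * (F p.2 * v p.2)) ∂(μ.prod μ) := by
          congr 1
          ext p
          have := (hκ0 p).ne'
          by_cases hp : p.1 ∈ Ω
          · simp only [functionalKernel, indicator_of_mem hp, Pi.one_apply]
            field_simp
          · simp [functionalKernel, indicator_of_notMem hp]
      _ = _ := by
          rw [integral_const_mul, integral_sub ((hv.integrable_indicator hΩ).mul_prod hF)
            (h1.mul_prod hFv), integral_prod_mul (Ω.indicator v) F,
            integral_prod_mul (Ω.indicator 1) fun x => F x * v x, hF0, integral_indicator_one hΩ]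
          field_simp
          ring
  · intro p hp
    have hp' : p.1 ∉ Ω := (not_not.1 hp).1
    simp [functionalKernel, indicator_of_notMem hp']

end EnergyMeasure

/-! ### Consequences of the normalization -/

/-- The field is nontrivially normed, so the generator satisfies `0 < ‖β‖ < 1`, while `‖β‖ = q⁻¹`.
This also excludes the default value `0` of `Nat.card`. -/
theorem one_lt_residueCard {K : Type*} [NontriviallyNormedField K] [IsUltrametricDist K]
    (hK : IsNormalizedAbs K) : 1 < (residueCard K : ℝ) := by
  obtain ⟨β, himg, hβ⟩ := hK
  obtain ⟨x, hx0, hx1⟩ := NormedField.exists_norm_lt_one K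
  have hx : x ∈ {x : K | ‖x‖ < 1} := hx1
  rw [himg] at hx
  obtain ⟨y, -, rfl⟩ := hx
  have hβ0 : 0 < ‖β‖ := norm_pos_iff.2 (left_ne_zero_of_mul (norm_pos_iff.1 hx0))
  have hβ1 : β ∈ {x : K | ‖x‖ < 1} := himg ▸ ⟨1, by simp, by simp⟩
  have hβ1' : ‖β‖ < 1 := hβ1
  rw [hβ] at hβ0 hβ1'
  exact (inv_lt_one₀ (inv_pos.1 hβ0)).1 hβ1'

theorem normConst_pos {K : Type*} [NontriviallyNormedField K] [IsUltrametricDist K]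
    (hK : IsNormalizedAbs K) (n : ℕ) {α : ℝ} (hα : 0 < α) : 0 < normConst K n α := by
  have hq := one_lt_residueCard hK
  refine div_pos (sub_pos.2 (Real.one_lt_rpow hq hα))
    (sub_pos.2 (Real.rpow_lt_one_of_one_lt_of_neg hq ?_))
  have : (0 : ℝ) ≤ n := n.cast_nonneg
  linarith

/-! ### The kernel and the weight on an ultrametric group -/

section Kernel

variable {E : Type*} [NormedAddCommGroup E]

/-- The kernel `‖x - y‖⁻ˢ`, modified on the diagonal, where it takes the value `R⁻ˢ`. -/
noncomputable def diffKernel (R s : ℝ) (p : E × E) : ℝ :=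
  -- The power `0 ^ (-s)` is `0` for `s ≠ 0`, but the density must be positive everywhere; the value
  -- `R ^ (-s)` also keeps `ω ≤ κ` on the diagonal.
  open Classical in if p.1 = p.2 then R ^ (-s) else ‖p.1 - p.2‖ ^ (-s)

/-- The weight `max(R, ‖y‖)⁻ˢ`. -/
noncomputable def maxWeight (R s : ℝ) (y : E) : ℝ := max R ‖y‖ ^ (-s)

theorem diffKernel_pos {R : ℝ} (hR : 0 < R) (s : ℝ) (p : E × E) : 0 < diffKernel R s p := by
  unfold diffKernel
  split_ifs with h
  · positivity
  · exact Real.rpow_pos_of_pos (norm_pos_iff.2 (sub_ne_zero.2 h)) _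

theorem maxWeight_pos {R : ℝ} (hR : 0 < R) (s : ℝ) (y : E) : 0 < maxWeight R s y :=
  Real.rpow_pos_of_pos (lt_max_of_lt_left hR) _

theorem measurable_maxWeight [MeasurableSpace E] [OpensMeasurableSpace E] (R s : ℝ) :
    Measurable (maxWeight R s : E → ℝ) :=
  (measurable_const.max measurable_norm).pow_const _

theorem measurable_diffKernel [MeasurableSpace E] [BorelSpace E] [SecondCountableTopology E]
    (R s : ℝ) : Measurable (diffKernel R s : E × E → ℝ) := by
  classical
  unfold diffKernel
  exact Measurable.ite (measurableSet_eq_fun measurable_fst measurable_snd) measurable_const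
    ((measurable_fst.sub measurable_snd).norm.pow_const _)

/-- By the ultrametric inequality, `‖x - y‖ ≤ max(‖x‖, ‖y‖) ≤ max(R, ‖y‖)`. -/
theorem maxWeight_le_diffKernel [IsUltrametricDist E] {R s : ℝ} (hs : 0 ≤ s)
    {x : E} (hx : ‖x‖ ≤ R) (y : E) : maxWeight R s y ≤ diffKernel R s (x, y) := by
  unfold diffKernel maxWeight
  split_ifs with h
  · simp only at h
    rw [max_eq_left (h ▸ hx)]
  · refine Real.rpow_le_rpow_of_nonpos (norm_pos_iff.2 (sub_ne_zero.2 h)) ?_ (neg_nonpos.2 hs)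
    rw [sub_eq_add_neg, ← norm_neg y]
    exact (IsUltrametricDist.norm_add_le_max x (-y)).trans (max_le_max_right _ hx)

/-- The energy integrands vanish on the diagonal, so changing the kernel there does not affect them.
-/
theorem div_rpow_eq_diffKernel_mul (R s : ℝ) (p : E × E) {a : ℝ} (ha : p.1 = p.2 → a = 0) :
    a / ‖p.1 - p.2‖ ^ s = diffKernel R s p * a := by
  unfold diffKernel
  split_ifs with h
  · simp [ha h]
  · rw [Real.rpow_neg (norm_nonneg _), div_eq_inv_mul]

end Kernel

/-! ### Sobolev spaces over the ball and the bound for Neumann data -/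

section Ball

theorem ball_eq_closedBall {K : Type*} [NontriviallyNormedField K] [IsUltrametricDist K] {n : ℕ}
    {N : ℤ} :
    ball K n N = Metric.closedBall 0 ((residueCard K : ℝ) ^ N) := by
  ext x
  simp [ball]

variable {K : Type*} [NontriviallyNormedField K] [IsUltrametricDist K] [LocallyCompactSpace K]
  [MeasurableSpace K] [BorelSpace K] {n : ℕ} {N : ℤ} {α : ℝ}

instance secondCountableTopology_of_locallyCompact (K : Type*) [NontriviallyNormedField K]
    [LocallyCompactSpace K] : SecondCountableTopology K :=
  have : ProperSpace K := ProperSpace.of_locallyCompactSpace K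
  inferInstance

instance sigmaFinite_haar : SigmaFinite (haar K n) := by unfold haar; infer_instance

theorem measurableSet_ball : MeasurableSet (ball K n N) := by
  rw [ball_eq_closedBall]
  exact Metric.isClosed_closedBall.measurableSet

theorem haar_ball_ne_top : haar K n (ball K n N) ≠ ∞ := by
  have : ProperSpace K := ProperSpace.of_locallyCompactSpace K
  have : IsFiniteMeasureOnCompacts (haar K n) := by unfold haar; infer_instance
  rw [ball_eq_closedBall]
  exact (isCompact_closedBall _ _).measure_ne_top

theorem haar_ball_ne_zero (hK : IsNormalizedAbs K) : haar K n (ball K n N) ≠ 0 := by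
  have : (haar K n).IsOpenPosMeasure := by unfold haar; infer_instance
  rw [ball_eq_closedBall]
  have hq := one_lt_residueCard hK
  exact (Metric.measure_closedBall_pos _ _ (by positivity)).ne'

/-- The measure `‖x - y‖^{-(n+α)} dx dy` on the region of integration of the energy form. -/
noncomputable def sobolevMeasure (K : Type*) [NontriviallyNormedField K] [IsUltrametricDist K]
    [LocallyCompactSpace K] [MeasurableSpace K] [BorelSpace K] (n : ℕ) (N : ℤ) (α : ℝ) :
    Measure ((Fin n → K) × (Fin n → K)) :=
  energyMeasure (haar K n) (ball K n N) (diffKernel ((residueCard K : ℝ) ^ N) (n + α))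

theorem energyForm_eq (hK : IsNormalizedAbs K) (u v : (Fin n → K) → ℝ) :
    energyForm N α u v = ∫ p, (u p.1 - u p.2) * (v p.1 - v p.2) ∂(sobolevMeasure K n N α) := by
  have hq := one_lt_residueCard hK
  rw [sobolevMeasure, integral_energyMeasure (measurable_diffKernel _ _)
    (diffKernel_pos (by positivity) _), energyForm, crossRegion]
  congr 1
  ext p
  exact div_rpow_eq_diffKernel_mul _ _ p fun h => by simp [h]

/-- The space `H^α_{Ω,ρ}` consists of the functions of finite energy if `ρ` is dominated by
`max(q^N, ‖x‖)^{-(n+α)}`. -/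
theorem memSobolev_iff (hK : IsNormalizedAbs K) (hα : 0 < α) {ρ : (Fin n → K) → ℝ}
    (hρ : IntegrableOn ρ (ball K n N)ᶜ (haar K n)) {C : ℝ}
    (hρC : ∀ᵐ x ∂((haar K n).restrict (ball K n N)ᶜ),
      |ρ x| ≤ C * maxWeight ((residueCard K : ℝ) ^ N) (n + α) x) (u : (Fin n → K) → ℝ) :
    MemSobolev N α ρ u ↔ AEMeasurable u (haar K n) ∧
      MemLp (fun p : (Fin n → K) × (Fin n → K) => u p.1 - u p.2) 2 (sobolevMeasure K n N α) := by
  have hq := one_lt_residueCard hK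
  have hR : 0 < (residueCard K : ℝ) ^ N := by positivity
  have hs : 0 ≤ (n : ℝ) + α := by positivity
  have henergy : ∀ p : (Fin n → K) × (Fin n → K),
      ENNReal.ofReal ((u p.1 - u p.2) ^ 2 / ‖p.1 - p.2‖ ^ ((n : ℝ) + α)) =
        ENNReal.ofReal (diffKernel ((residueCard K : ℝ) ^ N) (n + α) p) *
          ENNReal.ofReal ((u p.1 - u p.2) ^ 2) := fun p => by
    rw [div_rpow_eq_diffKernel_mul _ _ p fun h => by simp [h],
      ENNReal.ofReal_mul (diffKernel_pos hR _ p).le]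
  rw [MemSobolev]
  refine and_congr_right fun hu => ?_
  simp only [sobolevNormSq, henergy, crossRegion]
  rw [sobolevMeasure, memLp_difference_iff (measurable_diffKernel _ _) hu, ENNReal.add_lt_top]
  refine ⟨fun h => h.2, fun h => ⟨?_, h⟩⟩
  have hDu := (memLp_difference_iff (measurable_diffKernel _ _) hu).2 h
  have key := fun {S : Set (Fin n → K)} {ρ : (Fin n → K) → ℝ} (hρ : IntegrableOn ρ S (haar K n))
      {C : ℝ} hC => integrableOn_mul_sq (Ω := ball K n N)
    (measurable_diffKernel ((residueCard K : ℝ) ^ N) (n + α))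
    (measurable_maxWeight _ _) (maxWeight_pos hR _)
    (fun x hx y => maxWeight_le_diffKernel hs hx y) measurableSet_ball
    (haar_ball_ne_zero hK) hu hDu (S := S) (ρ := ρ) hρ (C := C) hC
  refine ENNReal.add_lt_top.2 ⟨?_, ?_⟩
  -- On the ball `ω` is the constant `R⁻ˢ`, so the weight `1` is dominated with `C = Rˢ`.
  · have h1 := key (S := ball K n N) (ρ := fun _ => 1) (integrableOn_const haar_ball_ne_top)
      (C := ((residueCard K : ℝ) ^ N) ^ ((n : ℝ) + α)) (by
        filter_upwards [ae_restrict_mem measurableSet_ball] with x hx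
        rw [maxWeight, max_eq_left hx, ← Real.rpow_add hR]
        simp)
    simp only [one_mul] at h1
    exact (hasFiniteIntegral_iff_ofReal (Eventually.of_forall fun x => sq_nonneg _)).1 h1.2
  · have h1 := (key hρ hρC).abs
    simp only [abs_mul, abs_pow, sq_abs] at h1
    exact (hasFiniteIntegral_iff_ofReal (Eventually.of_forall fun x => by positivity)).1 h1.2

/-- For `y ∈ Ω` and `x ∉ Ω` one has `‖x - y‖ = ‖x‖`, so the integrand is at most `2M ‖x‖⁻ˢ`, and
`‖x‖⁻ˢ` is the weight at `x`. -/
theorem abs_neumannOp_le (hK : IsNormalizedAbs K) {ψ : (Fin n → K) → ℝ} {M : ℝ}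
    (hM : ∀ x, |ψ x| ≤ M) {x : Fin n → K} (hx : x ∈ (ball K n N)ᶜ) :
    |neumannOp N α ψ x| ≤ |normConst K n α| * (2 * M * (haar K n).real (ball K n N)) *
      maxWeight ((residueCard K : ℝ) ^ N) (n + α) x := by
  have hx' : (residueCard K : ℝ) ^ N < ‖x‖ := not_le.1 hx
  have hq := one_lt_residueCard hK
  have hR : 0 < (residueCard K : ℝ) ^ N := by positivity
  rw [neumannOp, abs_mul, mul_assoc]
  refine mul_le_mul_of_nonneg_left ?_ (abs_nonneg _)
  rw [mul_right_comm (2 * M), ← Real.norm_eq_abs]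
  refine norm_setIntegral_le_of_norm_le_const haar_ball_ne_top.lt_top fun y hy => ?_
  have hyx : ‖y‖ < ‖x‖ := lt_of_le_of_lt hy hx'
  have hnorm : ‖x - y‖ = ‖x‖ := by
    rw [sub_eq_add_neg, IsUltrametricDist.norm_add_eq_max_of_norm_ne_norm (by simpa using hyx.ne'),
      norm_neg, max_eq_left hyx.le]
  rw [maxWeight, max_eq_right hx'.le, hnorm, Real.rpow_neg (norm_nonneg _), ← div_eq_mul_inv,
    norm_div, Real.norm_eq_abs, Real.norm_of_nonneg (Real.rpow_nonneg (norm_nonneg _) _)]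
  have := abs_sub (ψ x) (ψ y)
  have := hM x
  have := hM y
  gcongr
  linarith

end Ball

/-! ### Existence and uniqueness of weak solutions -/

section WeakSolution

variable {K : Type*} [NontriviallyNormedField K] [IsUltrametricDist K] [LocallyCompactSpace K]
  [MeasurableSpace K] [BorelSpace K] {n : ℕ} {N : ℤ} {α : ℝ}

/-- Membership in the space of functions of finite energy. -/
def HasFiniteEnergy (N : ℤ) (α : ℝ) (u : (Fin n → K) → ℝ) : Prop :=
  AEMeasurable u (haar K n) ∧
    MemLp (fun p : (Fin n → K) × (Fin n → K) => u p.1 - u p.2) 2 (sobolevMeasure K n N α)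

theorem hasFiniteEnergy_const (c : ℝ) : HasFiniteEnergy N α (fun _ : Fin n → K => c) :=
  ⟨aemeasurable_const, by simp⟩

theorem HasFiniteEnergy.sub {u v : (Fin n → K) → ℝ} (hu : HasFiniteEnergy N α u)
    (hv : HasFiniteEnergy N α v) : HasFiniteEnergy N α (fun x => u x - v x) := by
  refine ⟨hu.1.sub hv.1, (hu.2.sub hv.2).ae_eq (Eventually.of_forall fun p => ?_)⟩
  simp only [Pi.sub_apply]
  ring

theorem HasFiniteEnergy.const_mul {u : (Fin n → K) → ℝ} (hu : HasFiniteEnergy N α u) (c : ℝ) :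
    HasFiniteEnergy N α (fun x => c * u x) := by
  refine ⟨hu.1.const_mul c, (hu.2.const_mul c).ae_eq (Eventually.of_forall fun p => ?_)⟩
  simp only
  ring

theorem memSobolev_zero_iff (hK : IsNormalizedAbs K) (hα : 0 < α) (u : (Fin n → K) → ℝ) :
    MemSobolev N α (fun _ => 0) u ↔ HasFiniteEnergy N α u :=
  memSobolev_iff hK hα (C := 0) integrableOn_zero (by simp) u

theorem HasFiniteEnergy.memLp_ball (hK : IsNormalizedAbs K) (hα : 0 < α)
    {v : (Fin n → K) → ℝ} (hv : HasFiniteEnergy N α v) :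
    MemLp v 2 ((haar K n).restrict (ball K n N)) := by
  have h := ((memSobolev_zero_iff hK hα v).2 hv).2
  rw [sobolevNormSq, add_assoc] at h
  rw [memLp_two_iff_integrable_sq hv.1.aestronglyMeasurable.restrict]
  refine ⟨(hv.1.aestronglyMeasurable.restrict).pow 2, ?_⟩
  rw [hasFiniteIntegral_iff_ofReal (Eventually.of_forall fun x => sq_nonneg _)]
  exact (ENNReal.add_lt_top.1 h).1

/-- Follows from `|v| ≤ 1 + v²`: both `|ρ|` and `|ρ| v²` are integrable off the ball. -/
theorem MemSobolev.integrableOn_mul {ρ v : (Fin n → K) → ℝ}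
    (hρ : IntegrableOn ρ (ball K n N)ᶜ (haar K n)) (hv : MemSobolev N α ρ v) :
    IntegrableOn (fun x => ρ x * v x) (ball K n N)ᶜ (haar K n) := by
  have hm := hρ.aestronglyMeasurable.mul hv.1.aestronglyMeasurable.restrict
  have h := hv.2
  rw [sobolevNormSq] at h
  have h1 : IntegrableOn (fun x => |ρ x| * v x ^ 2) (ball K n N)ᶜ (haar K n) := by
    refine ⟨(continuous_abs.comp_aestronglyMeasurable hρ.aestronglyMeasurable).mul
      (hv.1.aestronglyMeasurable.restrict.pow 2), ?_⟩
    rw [hasFiniteIntegral_iff_ofReal (Eventually.of_forall fun x => by positivity)]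
    exact (ENNReal.add_lt_top.1 (ENNReal.add_lt_top.1 h).1).2
  refine Integrable.mono' (hρ.abs.add h1) hm (Eventually.of_forall fun x => ?_)
  simp only [Pi.add_apply, norm_mul, Real.norm_eq_abs]
  have h2 : |v x| ≤ 1 + v x ^ 2 := by
    nlinarith [sq_abs (v x), sq_nonneg (|v x| - 1), abs_nonneg (v x)]
  nlinarith [mul_le_mul_of_nonneg_left h2 (abs_nonneg (ρ x))]

variable {f g : (Fin n → K) → ℝ}

open Classical in
/-- The function equal to `f` on the ball and to `g` on its complement. -/
noncomputable def neumannData (N : ℤ) (f g : (Fin n → K) → ℝ) : (Fin n → K) → ℝ :=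
  (ball K n N).piecewise f g

omit [LocallyCompactSpace K] [MeasurableSpace K] [BorelSpace K] in
theorem neumannData_of_mem {x : Fin n → K} (hx : x ∈ ball K n N) :
    neumannData N f g x = f x :=
  if_pos hx

omit [LocallyCompactSpace K] [MeasurableSpace K] [BorelSpace K] in
theorem neumannData_of_notMem {x : Fin n → K} (hx : x ∉ ball K n N) :
    neumannData N f g x = g x :=
  if_neg hx

theorem integrable_neumannData_mul {v : (Fin n → K) → ℝ}
    (h1 : IntegrableOn (fun x => f x * v x) (ball K n N) (haar K n))
    (h2 : IntegrableOn (fun x => g x * v x) (ball K n N)ᶜ (haar K n)) :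
    Integrable (fun x => neumannData N f g x * v x) (haar K n) ∧
      ∫ x, neumannData N f g x * v x ∂(haar K n) =
        ∫ x in ball K n N, f x * v x ∂(haar K n) + ∫ x in (ball K n N)ᶜ, g x * v x ∂(haar K n) := by
  classical
  have h : (fun x => neumannData N f g x * v x) =
      (ball K n N).piecewise (fun x => f x * v x) fun x => g x * v x := by
    ext x
    by_cases hx : x ∈ ball K n N <;> simp [neumannData, hx]
  rw [h]
  exact ⟨Integrable.piecewise measurableSet_ball h1 h2,
    integral_piecewise measurableSet_ball h1 h2⟩

theorem integrable_neumannData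
    (hf : MemLp f 2 ((haar K n).restrict (ball K n N)))
    (hg : IntegrableOn g (ball K n N)ᶜ (haar K n)) :
    Integrable (neumannData N f g) (haar K n) ∧
      ∫ x, neumannData N f g x ∂(haar K n) =
        ∫ x in ball K n N, f x ∂(haar K n) + ∫ x in (ball K n N)ᶜ, g x ∂(haar K n) := by
  have : IsFiniteMeasure ((haar K n).restrict (ball K n N)) :=
    isFiniteMeasure_restrict.2 haar_ball_ne_top
  have hf' : IntegrableOn f (ball K n N) (haar K n) := hf.integrable (by norm_num)
  simpa using integrable_neumannData_mul (v := fun _ => 1) (by simpa using hf') (by simpa using hg)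

/-- On the ball the weight is constant and `f` is in `L²`; off it, `g² / ω ≤ C |g|`. -/
theorem integrable_sq_neumannData_div (hK : IsNormalizedAbs K)
    (hf : MemLp f 2 ((haar K n).restrict (ball K n N)))
    (hg : IntegrableOn g (ball K n N)ᶜ (haar K n)) {C : ℝ}
    (hgC : ∀ᵐ x ∂((haar K n).restrict (ball K n N)ᶜ),
      |g x| ≤ C * maxWeight ((residueCard K : ℝ) ^ N) (n + α) x) :
    Integrable (fun x => neumannData N f g x ^ 2 /
      maxWeight ((residueCard K : ℝ) ^ N) (n + α) x) (haar K n) := by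
  have hq := one_lt_residueCard hK
  have hR : 0 < (residueCard K : ℝ) ^ N := by positivity
  have hm : AEMeasurable (fun x => neumannData N f g x ^ 2 /
      maxWeight ((residueCard K : ℝ) ^ N) (n + α) x) (haar K n) :=
    ((integrable_neumannData hf hg).1.aemeasurable.pow_const 2).div
      (measurable_maxWeight _ _).aemeasurable
  rw [← integrableOn_univ, ← union_compl_self (ball K n N)]
  refine IntegrableOn.union ?_ ?_
  · refine ((hf.integrable_sq.mul_const
      ((((residueCard K : ℝ) ^ N) ^ (-((n : ℝ) + α)))⁻¹)).congr ?_)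
    filter_upwards [ae_restrict_mem measurableSet_ball] with x hx
    rw [maxWeight, max_eq_left hx, neumannData_of_mem hx, div_eq_mul_inv]
  · refine Integrable.mono' (hg.abs.const_mul C) hm.restrict.aestronglyMeasurable ?_
    filter_upwards [hgC, ae_restrict_mem measurableSet_ball.compl] with x hx hxc
    have hω := maxWeight_pos hR ((n : ℝ) + α) x
    rw [neumannData_of_notMem hxc, norm_div, norm_pow, Real.norm_eq_abs,
      Real.norm_of_nonneg hω.le, div_le_iff₀ hω]
    nlinarith [mul_le_mul_of_nonneg_left hx (abs_nonneg (g x))]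

/-- The weak formulation in terms of the energy measure. -/
theorem isWeakSolution_iff (hK : IsNormalizedAbs K) (hα : 0 < α)
    (hf : MemLp f 2 ((haar K n).restrict (ball K n N)))
    (hg : IntegrableOn g (ball K n N)ᶜ (haar K n)) {C : ℝ}
    (hgC : ∀ᵐ x ∂((haar K n).restrict (ball K n N)ᶜ),
      |g x| ≤ C * maxWeight ((residueCard K : ℝ) ^ N) (n + α) x) (u : (Fin n → K) → ℝ) :
    IsWeakSolution N α f g u ↔ HasFiniteEnergy N α u ∧
      ∀ v : (Fin n → K) → ℝ, HasFiniteEnergy N α v →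
        normConst K n α / 2 *
            ∫ p, (u p.1 - u p.2) * (v p.1 - v p.2) ∂(sobolevMeasure K n N α) =
          ∫ x, neumannData N f g x * v x ∂(haar K n) := by
  rw [IsWeakSolution, memSobolev_zero_iff hK hα]
  refine and_congr_right fun hu => forall_congr' fun v => ?_
  have hiff := memSobolev_iff hK hα hg hgC v
  refine imp_congr_ctx hiff fun hv => ?_
  rw [energyForm_eq hK, (integrable_neumannData_mul
    (hf.integrable_mul (HasFiniteEnergy.memLp_ball hK hα hv))
    ((hiff.2 hv).integrableOn_mul hg)).2]

theorem exists_isWeakSolution (hK : IsNormalizedAbs K) (hα : 0 < α)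
    (hf : MemLp f 2 ((haar K n).restrict (ball K n N)))
    (hg : IntegrableOn g (ball K n N)ᶜ (haar K n)) {C : ℝ}
    (hgC : ∀ᵐ x ∂((haar K n).restrict (ball K n N)ᶜ),
      |g x| ≤ C * maxWeight ((residueCard K : ℝ) ^ N) (n + α) x)
    (h0 : ∫ x, neumannData N f g x ∂(haar K n) = 0) :
    ∃ u : (Fin n → K) → ℝ, IsWeakSolution N α f g u := by
  have hq := one_lt_residueCard hK
  have hR : 0 < (residueCard K : ℝ) ^ N := by positivity
  have hs : 0 ≤ (n : ℝ) + α := by positivity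
  have hc := normConst_pos hK n hα
  have hF := integrable_neumannData hf hg
  have : IsFiniteMeasure ((haar K n).restrict (ball K n N)) :=
    isFiniteMeasure_restrict.2 haar_ball_ne_top
  obtain ⟨u, hu, hDu, huv⟩ := exists_integral_difference_mul_eq (Ω := ball K n N)
    energyMeasure_absolutelyContinuous
    (restrict_prod_absolutelyContinuous_energyMeasure (measurable_diffKernel _ _)
      (diffKernel_pos hR ((n : ℝ) + α)))
    measurableSet_ball (haar_ball_ne_zero hK)
    (memLp_functionalKernel (Ω := ball K n N) (measurable_diffKernel _ _) (diffKernel_pos hR _)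
      (maxWeight_pos hR _) (fun x hx y => maxWeight_le_diffKernel hs hx y) measurableSet_ball
      haar_ball_ne_top hF.1.aestronglyMeasurable (integrable_sq_neumannData_div hK hf hg hgC))
  -- The factor `2/c` cancels the `c/2` in front of the energy form.
  refine ⟨fun x => 2 / normConst K n α * u x, (isWeakSolution_iff hK hα hf hg hgC _).2
    ⟨HasFiniteEnergy.const_mul ⟨hu, hDu⟩ _, fun v hv => ?_⟩⟩
  have hvg := (memSobolev_iff hK hα hg hgC v).2 hv
  have hFv := integrable_neumannData_mul (hf.integrable_mul (hv.memLp_ball hK hα))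
    (hvg.integrableOn_mul hg)
  have h1 := integral_functionalKernel_mul_difference
    (measurable_diffKernel ((residueCard K : ℝ) ^ N) (n + α)) (diffKernel_pos hR _)
    measurableSet_ball haar_ball_ne_top (haar_ball_ne_zero hK) hF.1 h0
    ((hv.memLp_ball hK hα).integrable (by norm_num)) hFv.1
  rw [← h1, ← huv v hv.1 hv.2, sobolevMeasure, ← integral_const_mul]
  congr 1
  ext p
  field_simp

theorem isWeakSolution_iff_ae_eq_add_const (hK : IsNormalizedAbs K) (hα : 0 < α)
    (hf : MemLp f 2 ((haar K n).restrict (ball K n N)))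
    (hg : IntegrableOn g (ball K n N)ᶜ (haar K n)) {C : ℝ}
    (hgC : ∀ᵐ x ∂((haar K n).restrict (ball K n N)ᶜ),
      |g x| ≤ C * maxWeight ((residueCard K : ℝ) ^ N) (n + α) x) {u w : (Fin n → K) → ℝ}
    (hu : IsWeakSolution N α f g u) :
    IsWeakSolution N α f g w ↔ ∃ k : ℝ, ∀ᵐ x ∂(haar K n), w x = u x + k := by
  have hq := one_lt_residueCard hK
  have hR : 0 < (residueCard K : ℝ) ^ N := by positivity
  have hc := normConst_pos hK n hα
  rw [isWeakSolution_iff hK hα hf hg hgC] at hu ⊢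
  constructor
  · intro hw
    have hd := hw.1.sub hu.1
    -- Both equations are tested with `w - u` itself, so the energy of `w - u` vanishes.
    have heq := mul_left_cancel₀ (by positivity) ((hw.2 _ hd).trans (hu.2 _ hd).symm)
    have hsub := integral_sub (hw.1.2.integrable_mul hd.2) (hu.1.2.integrable_mul hd.2)
    simp only [Pi.mul_apply, heq, sub_self] at hsub
    have hsq : ∫ p : (Fin n → K) × (Fin n → K),
        ((w p.1 - u p.1) - (w p.2 - u p.2)) ^ 2 ∂(sobolevMeasure K n N α) = 0 := by
      rw [← hsub]
      congr 1
      ext p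
      ring
    rw [integral_eq_zero_iff_of_nonneg (fun p => sq_nonneg _) hd.2.integrable_sq] at hsq
    obtain ⟨k, hk⟩ := exists_ae_eq_const_of_difference_eq_zero (Ω := ball K n N)
      (u := fun x => w x - u x)
      (restrict_prod_absolutelyContinuous_energyMeasure (measurable_diffKernel _ _)
        (diffKernel_pos hR ((n : ℝ) + α))) measurableSet_ball (haar_ball_ne_zero hK)
      (hsq.mono fun p hp => pow_eq_zero_iff two_ne_zero |>.1 hp)
    exact ⟨k, hk.mono fun x hx => by linarith⟩
  · rintro ⟨k, hk⟩
    have hD : (fun p : (Fin n → K) × (Fin n → K) => u p.1 - u p.2) =ᵐ[sobolevMeasure K n N α]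
        fun p => w p.1 - w p.2 := by
      filter_upwards [ae_fst_snd_of_ae energyMeasure_absolutelyContinuous hk] with p hp
      rw [hp.1, hp.2]
      ring
    refine ⟨⟨(hu.1.1.add_const k).congr (hk.mono fun x hx => hx.symm), hu.1.2.ae_eq hD⟩,
      fun v hv => ?_⟩
    rw [← hu.2 v hv]
    congr 1
    refine integral_congr_ae ?_
    filter_upwards [hD] with p hp
    rw [hp]

/-- The constant `1` has finite energy, so it is a test function, and its differences vanish. -/
theorem IsWeakSolution.integral_neumannData_eq_zero (hK : IsNormalizedAbs K) (hα : 0 < α)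
    (hf : MemLp f 2 ((haar K n).restrict (ball K n N)))
    (hg : IntegrableOn g (ball K n N)ᶜ (haar K n)) {C : ℝ}
    (hgC : ∀ᵐ x ∂((haar K n).restrict (ball K n N)ᶜ),
      |g x| ≤ C * maxWeight ((residueCard K : ℝ) ^ N) (n + α) x) {u : (Fin n → K) → ℝ}
    (hu : IsWeakSolution N α f g u) : ∫ x, neumannData N f g x ∂(haar K n) = 0 := by
  rw [isWeakSolution_iff hK hα hf hg hgC] at hu
  simpa using (hu.2 _ (hasFiniteEnergy_const 1)).symm

end WeakSolution

end LocalFieldNeumann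

theorem theorem6p1 {K : Type*} [NontriviallyNormedField K] [IsUltrametricDist K]
    [LocallyCompactSpace K] [MeasurableSpace K] [BorelSpace K]
    (hK : LocalFieldNeumann.IsNormalizedAbs K)
    (n : ℕ) (hn : 1 ≤ n) (N : ℤ) (α : ℝ) (hα : 0 < α)
    (f g : (Fin n → K) → ℝ)
    (hf : MemLp f 2 ((LocalFieldNeumann.haar K n).restrict (LocalFieldNeumann.ball K n N)))
    (hg : IntegrableOn g (LocalFieldNeumann.ball K n N)ᶜ (LocalFieldNeumann.haar K n))
    (hψ : ∃ ψ : (Fin n → K) → ℝ, LocalFieldNeumann.IsLocConst ψ ∧ (∃ M : ℝ, ∀ x, |ψ x| ≤ M) ∧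
      ∀ᵐ x ∂((LocalFieldNeumann.haar K n).restrict (LocalFieldNeumann.ball K n N)ᶜ),
        LocalFieldNeumann.neumannOp N α ψ x = g x) :
    ((∃ u : (Fin n → K) → ℝ, LocalFieldNeumann.IsWeakSolution N α f g u) ↔
      ∫ x in LocalFieldNeumann.ball K n N, f x ∂(LocalFieldNeumann.haar K n) =
        - ∫ y in (LocalFieldNeumann.ball K n N)ᶜ, g y ∂(LocalFieldNeumann.haar K n)) ∧
    (∫ x in LocalFieldNeumann.ball K n N, f x ∂(LocalFieldNeumann.haar K n) =
        - ∫ y in (LocalFieldNeumann.ball K n N)ᶜ, g y ∂(LocalFieldNeumann.haar K n) →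
      ∀ u : (Fin n → K) → ℝ, LocalFieldNeumann.IsWeakSolution N α f g u →
        ∀ w : (Fin n → K) → ℝ, LocalFieldNeumann.IsWeakSolution N α f g w ↔
          ∃ k : ℝ, ∀ᵐ x ∂(LocalFieldNeumann.haar K n), w x = u x + k) := by
  obtain ⟨ψ, -, ⟨M, hM⟩, hψg⟩ := hψ
  have hgC : ∀ᵐ x ∂((LocalFieldNeumann.haar K n).restrict (LocalFieldNeumann.ball K n N)ᶜ),
      |g x| ≤ |LocalFieldNeumann.normConst K n α| *
        (2 * M * (LocalFieldNeumann.haar K n).real (LocalFieldNeumann.ball K n N)) *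
        LocalFieldNeumann.maxWeight ((LocalFieldNeumann.residueCard K : ℝ) ^ N) (n + α) x := by
    filter_upwards [hψg,
      ae_restrict_mem LocalFieldNeumann.measurableSet_ball.compl] with x hx hxc
    rw [← hx]
    exact LocalFieldNeumann.abs_neumannOp_le hK hM hxc
  refine ⟨?_, fun _ u hu w =>
    LocalFieldNeumann.isWeakSolution_iff_ae_eq_add_const hK hα hf hg hgC hu⟩
  rw [eq_neg_iff_add_eq_zero, ← (LocalFieldNeumann.integrable_neumannData hf hg).2]
  exact ⟨fun ⟨u, hu⟩ => hu.integral_neumannData_eq_zero hK hα hf hg hgC,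
    LocalFieldNeumann.exists_isWeakSolution hK hα hf hg hgC⟩
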